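/- Let $(W,S)$ be a Coxeter group with $W$ finite and simple reflections $S=(s_i)_{i\in I}$, and let $\mathbb{K}$ be a field. For $i\in I$, let $\pi_i,\overline{\pi}_i$ be the operators acting on the right of $W$ by $w.\pi_i=w$ and $w.\overline{\pi}_i=ws_i$ if $\ell(ws_i)<\ell(w)$, and by $w.\pi_i=ws_i$ and $w.\overline{\pi}_i=w$ otherwise. The biHecke monoid $M=M(W)$ is the submonoid of functions $W\to W$, with product given by $w.(fg)=(w.f).g$, generated by all $\pi_i$ and $\overline{\pi}_i$, $i\in I$. Put $M_1:=\{f\in M\mid 1.f=1\}$. For every $f\in M_1$ there is $k>0$ with $f^{k+1}=f^k$, and $f^\infty:=f^k$ denotes the resulting idempotent. For $w\in W$, let $S_w$ be the one-dimensional right $\mathbb{K}[M_1]$-module with basis $\{\epsilon_w\}$ on which $f\in M_1$ acts by $\epsilon_w.f=\epsilon_w$ if $w.f=w$ and $\epsilon_w.f=0$ otherwise. \textbf{Theorem.} The (Jacobson) radical of $\mathbb{K}[M_1]$ is the ideal having the family $(f^\infty-f)_f$, for $f\in M_1$ non-idempotent, as a $\mathbb{K}$-basis. The quotient of $\mathbb{K}[M_1]$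 by its radical is commutative. All simple right $M_1$-modules over $\mathbb{K}$ (that is, simple right $\mathbb{K}[M_1]$-modules) are one-dimensional over $\mathbb{K}$. Moreover, the family $(S_w)_{w\in W}$ is a complete system of representatives of the simple right $M_1$-modules: each $S_w$ is simple, $S_w\not\cong S_{w'}$ for $w\neq w'$, and every simple right $M_1$-module is isomorphic to some $S_w$. -/

import Mathlib

/-! The biHecke monoid of a Coxeter group, its Borel submonoid, and the one-dimensional right
modules of the latter. -/

namespace BiHecke

universe u v w

/-! ### Preliminaries on descents -/

section Descents

variable {B : Type u} {W : Type v} [Group W] {M : CoxeterMatrix B} (cs : CoxeterSystem M W)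

open Classical in
/-- The action of a simple reflection on `W × ZMod 2` that records the parity of inversions. -/
noncomputable def parityStep (i : B) : Function.End (W × ZMod 2) :=
  fun p => (cs.simple i * p.1 * cs.simple i, p.2 + if p.1 = cs.simple i then 1 else 0)

open Classical in
theorem parityStep_pow (i j : B) (k : ℕ) (t : W) (e : ZMod 2) :
    ((parityStep cs i * parityStep cs j) ^ k) (t, e) =
      ((cs.simple i * cs.simple j) ^ k * t * ((cs.simple i * cs.simple j) ^ k)⁻¹,
        e + ∑ n ∈ Finset.range (2 * k),
          if t = cs.simple j * (cs.simple i * cs.simple j) ^ n then 1 else 0) := by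
  induction k with
  | zero =>
    simp only [pow_zero, mul_zero, Finset.range_zero, Finset.sum_empty, one_mul, inv_one, mul_one,
      add_zero]
    rfl
  | succ k ih =>
    have hconj : ∀ n : ℕ, (cs.simple i * cs.simple j) ^ n * cs.simple j =
        cs.simple j * ((cs.simple i * cs.simple j) ^ n)⁻¹ := by
      intro n
      induction n with
      | zero => simp
      | succ n ihn =>
        rw [pow_succ', mul_assoc, ihn, ← pow_succ', pow_succ]
        simp [mul_assoc]
    have h1 : (cs.simple i * cs.simple j) ^ k * t * ((cs.simple i * cs.simple j) ^ k)⁻¹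
        = cs.simple j ↔ t = cs.simple j * (cs.simple i * cs.simple j) ^ (2 * k) := by
      rw [mul_inv_eq_iff_eq_mul, ← eq_inv_mul_iff_mul_eq, two_mul, pow_add]
      have : ((cs.simple i * cs.simple j) ^ k)⁻¹ * (cs.simple j * (cs.simple i * cs.simple j) ^ k)
          = cs.simple j * ((cs.simple i * cs.simple j) ^ k * (cs.simple i * cs.simple j) ^ k) := by
        rw [inv_mul_eq_iff_eq_mul, ← mul_assoc, ← mul_assoc, hconj]
        simp [mul_assoc]
      rw [this]
    have h2 : cs.simple j * ((cs.simple i * cs.simple j) ^ k * t *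
        ((cs.simple i * cs.simple j) ^ k)⁻¹) * cs.simple j = cs.simple i ↔
          t = cs.simple j * (cs.simple i * cs.simple j) ^ (2 * k + 1) := by
      have e1 : cs.simple j * ((cs.simple i * cs.simple j) ^ k * t *
        ((cs.simple i * cs.simple j) ^ k)⁻¹) * cs.simple j = cs.simple i ↔
          (cs.simple i * cs.simple j) ^ k * t * ((cs.simple i * cs.simple j) ^ k)⁻¹
            = cs.simple j * cs.simple i * cs.simple j := by
        constructor
        · intro h
          generalize (cs.simple i * cs.simple j) ^ k * t * ((cs.simple i * cs.simple j) ^ k)⁻¹ = y at h ⊢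
          rw [← h]
          simp [mul_assoc]
        · intro h
          rw [h]
          simp [mul_assoc]
      rw [e1, mul_inv_eq_iff_eq_mul, ← eq_inv_mul_iff_mul_eq]
      have : ((cs.simple i * cs.simple j) ^ k)⁻¹ * (cs.simple j * cs.simple i * cs.simple j *
          (cs.simple i * cs.simple j) ^ k)
          = cs.simple j * (cs.simple i * cs.simple j) ^ (2 * k + 1) := by
        rw [inv_mul_eq_iff_eq_mul, ← mul_assoc, hconj,
          show 2 * k + 1 = k + (1 + k) by omega, pow_add, pow_add, pow_one]
        simp [mul_assoc]
      rw [this]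
    rw [pow_succ']
    change (parityStep cs i) ((parityStep cs j)
      (((parityStep cs i * parityStep cs j) ^ k) (t, e))) = _
    rw [ih]
    simp only [parityStep, h1, h2]
    rw [show 2 * (k + 1) = 2 * k + 1 + 1 by omega, Finset.sum_range_succ, Finset.sum_range_succ]
    refine Prod.ext ?_ ?_
    · simp [pow_succ', mul_assoc]
    · simp only [add_assoc]

theorem parityStep_isLiftable : M.IsLiftable (parityStep cs) := by
  classical
  intro i j
  funext ⟨t, e⟩
  rw [parityStep_pow, cs.simple_mul_simple_pow, two_mul, Finset.sum_range_add]
  simp only [pow_add, cs.simple_mul_simple_pow, one_mul, inv_one, mul_one, CharTwo.add_self_eq_zero,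
    add_zero]
  rfl

open Classical in
theorem lift_parityStep_wordProd (ω : List B) (t : W) (e : ZMod 2) :
    cs.lift ⟨parityStep cs, parityStep_isLiftable cs⟩ (cs.wordProd ω) (t, e) =
      (cs.wordProd ω * t * (cs.wordProd ω)⁻¹, e + ((cs.rightInvSeq ω).count t : ZMod 2)) := by
  induction ω with
  | nil => simp; rfl
  | cons i ω ih =>
    rw [cs.wordProd_cons, map_mul, cs.lift_apply_simple]
    change parityStep cs i (cs.lift ⟨parityStep cs, parityStep_isLiftable cs⟩
      (cs.wordProd ω) (t, e)) = _
    rw [ih]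
    have h : cs.wordProd ω * t * (cs.wordProd ω)⁻¹ = cs.simple i ↔
        (cs.wordProd ω)⁻¹ * cs.simple i * cs.wordProd ω = t := by
      rw [mul_inv_eq_iff_eq_mul, mul_assoc, inv_mul_eq_iff_eq_mul, eq_comm]
    refine Prod.ext ?_ ?_
    · simp [parityStep, mul_assoc]
    · simp [parityStep, CoxeterSystem.rightInvSeq, List.count_cons, h, add_assoc]

/-- The parity of the number of occurrences of `t` as an inversion of `x`. -/
noncomputable def invParity (x t : W) : ZMod 2 :=
  (cs.lift ⟨parityStep cs, parityStep_isLiftable cs⟩ x (t, 0)).2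

open Classical in
theorem invParity_simple_mul (i : B) (x t : W) :
    invParity cs (cs.simple i * x) t =
      invParity cs x t + if x * t * x⁻¹ = cs.simple i then 1 else 0 := by
  obtain ⟨ω, rfl⟩ := cs.wordProd_surjective x
  rw [invParity, map_mul, cs.lift_apply_simple]
  change (parityStep cs i (cs.lift ⟨parityStep cs, parityStep_isLiftable cs⟩
      (cs.wordProd ω) (t, 0))).2 = _
  rw [invParity, lift_parityStep_wordProd]
  rfl

theorem invParity_of_isRightDescent {x : W} {i : B} (h : cs.IsRightDescent x i) :
    invParity cs x (cs.simple i) = 1 := by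
  classical
  obtain ⟨ω, hω, hx⟩ := cs.exists_isReduced (x * cs.simple i)
  have hx' : x = cs.wordProd (ω.concat i) := by
    rw [cs.wordProd_concat, ← hx]
    simp
  have hred : cs.IsReduced (ω.concat i) := by
    rw [CoxeterSystem.IsReduced, ← hx', List.length_concat, ← hω.eq, ← hx]
    exact ((cs.isRightDescent_iff).1 h).symm
  rw [invParity, hx', lift_parityStep_wordProd]
  have hmem : cs.simple i ∈ cs.rightInvSeq (ω.concat i) := by
    rw [cs.rightInvSeq_concat]
    simp
  simp [-List.concat_eq_append, List.count_eq_one_of_mem hred.nodup_rightInvSeq hmem]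

theorem invParity_of_not_isRightDescent {x : W} {i : B} (h : ¬ cs.IsRightDescent x i) :
    invParity cs x (cs.simple i) = 0 := by
  classical
  obtain ⟨ω, hω, hx⟩ := cs.exists_isReduced x
  have hred : cs.IsReduced (ω.concat i) := by
    rw [CoxeterSystem.IsReduced, cs.wordProd_concat, ← hx, List.length_concat, ← hω.eq, ← hx]
    exact (cs.not_isRightDescent_iff).1 h
  have hnd := hred.nodup_rightInvSeq
  rw [cs.rightInvSeq_concat, List.concat_eq_append, List.nodup_append] at hnd
  have hnot : cs.simple i ∉ cs.rightInvSeq ω := by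
    intro hm
    exact hnd.2.2 (cs.simple i) (List.mem_map.2 ⟨_, hm, by simp⟩) (cs.simple i) (by simp) rfl
  rw [invParity, hx, lift_parityStep_wordProd]
  simp [List.count_eq_zero_of_not_mem hnot]

/-- If left multiplication by a simple reflection changes whether `i` is a right descent, then
it agrees with right multiplication by the simple reflection `i`. -/
theorem simple_mul_eq_of_descent_ne {j i : B} {x : W}
    (h : ¬ (cs.IsRightDescent (cs.simple j * x) i ↔ cs.IsRightDescent x i)) :
    cs.simple j * x = x * cs.simple i := by
  classical
  have key := invParity_simple_mul cs j x (cs.simple i)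
  by_cases hc : x * cs.simple i * x⁻¹ = cs.simple j
  · rw [← hc]
    simp
  · rw [if_neg hc, add_zero] at key
    by_cases h1 : cs.IsRightDescent (cs.simple j * x) i <;> by_cases h2 : cs.IsRightDescent x i
    · exact absurd ⟨fun _ => h2, fun _ => h1⟩ h
    · rw [invParity_of_isRightDescent cs h1, invParity_of_not_isRightDescent cs h2] at key
      exact absurd key one_ne_zero
    · rw [invParity_of_not_isRightDescent cs h1, invParity_of_isRightDescent cs h2] at key
      exact absurd key.symm one_ne_zero
    · exact absurd ⟨fun a => absurd a h1, fun a => absurd a h2⟩ h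

end Descents

/-! ### The biHecke monoid and its Borel submonoid -/

section Monoid

variable {B : Type u} {W : Type v} [Group W] {M : CoxeterMatrix B} (cs : CoxeterSystem M W)

open Classical in
/-- The elementary bubble antisorting operator `π_i`. -/
noncomputable def antisort (i : B) (x : W) : W :=
  if cs.IsRightDescent x i then x else x * cs.simple i

open Classical in
/-- The elementary bubble sorting operator `π̄_i`. -/
noncomputable def sort (i : B) (x : W) : W :=
  if cs.IsRightDescent x i then x * cs.simple i else x

/-- The biHecke monoid, generated by the antisorting and sorting operators. Operators act on the
right of `W`, that is `x.(f g) = (x.f).g`; this is the opposite of the usual composition monoid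
`Function.End W`, and `x.f` is written `f.unop x`. -/
def biHecke : Submonoid (Function.End W)ᵐᵒᵖ :=
  Submonoid.closure
    (Set.range (fun i : B => MulOpposite.op (antisort cs i : Function.End W)) ∪
      Set.range (fun i : B => MulOpposite.op (sort cs i : Function.End W)))

/-- The Borel submonoid `M₁`: the elements `f` of the biHecke monoid with `1.f = 1`. -/
def borel : Submonoid (Function.End W)ᵐᵒᵖ where
  carrier := {f | f ∈ biHecke cs ∧ f.unop 1 = 1}
  one_mem' := ⟨one_mem _, rfl⟩
  mul_mem' := by
    rintro f g ⟨hf, hf1⟩ ⟨hg, hg1⟩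
    refine ⟨mul_mem hf hg, ?_⟩
    change g.unop (f.unop 1) = 1
    rw [hf1, hg1]

/-- The image `x.f` of `x : W` under `f ∈ M₁`. -/
def act (x : W) (f : borel cs) : W := (f : (Function.End W)ᵐᵒᵖ).unop x

theorem act_one (x : W) : act cs x 1 = x := rfl

theorem act_mul (x : W) (f g : borel cs) : act cs x (f * g) = act cs (act cs x f) g := rfl

theorem one_act (f : borel cs) : act cs 1 f = 1 := f.2.2

theorem biHecke_simple_mul {f : (Function.End W)ᵐᵒᵖ} (hf : f ∈ biHecke cs) (j : B) (x : W) :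
    f.unop (cs.simple j * x) = f.unop x ∨ f.unop (cs.simple j * x) = cs.simple j * f.unop x := by
  classical
  induction hf using Submonoid.closure_induction generalizing x with
  | one => exact Or.inr rfl
  | mul f g _ _ ihf ihg =>
    change g.unop (f.unop (cs.simple j * x)) = g.unop (f.unop x) ∨
      g.unop (f.unop (cs.simple j * x)) = cs.simple j * g.unop (f.unop x)
    rcases ihf x with h | h <;> rw [h]
    · exact Or.inl rfl
    · exact ihg _
  | mem f hf =>
    rcases hf with ⟨i, rfl⟩ | ⟨i, rfl⟩
    · change antisort cs i (cs.simple j * x) = antisort cs i x ∨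
        antisort cs i (cs.simple j * x) = cs.simple j * antisort cs i x
      have key := @simple_mul_eq_of_descent_ne _ _ _ _ cs j i x
      unfold antisort
      by_cases h1 : cs.IsRightDescent (cs.simple j * x) i <;> by_cases h2 : cs.IsRightDescent x i
      · simp [h1, h2]
      · left
        rw [if_pos h1, if_neg h2]
        exact key (by simp [h1, h2])
      · left
        rw [if_neg h1, if_pos h2, key (by simp [h1, h2])]
        simp
      · simp [h1, h2, mul_assoc]
    · change sort cs i (cs.simple j * x) = sort cs i x ∨
        sort cs i (cs.simple j * x) = cs.simple j * sort cs i x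
      have key := @simple_mul_eq_of_descent_ne _ _ _ _ cs j i x
      unfold sort
      by_cases h1 : cs.IsRightDescent (cs.simple j * x) i <;> by_cases h2 : cs.IsRightDescent x i
      · simp [h1, h2, mul_assoc]
      · left
        rw [if_pos h1, if_neg h2, key (by simp [h1, h2])]
        simp
      · left
        rw [if_neg h1, if_pos h2]
        exact key (by simp [h1, h2])
      · simp [h1, h2]

/-- An element of `M₁` fixes a given element of `W` or strictly decreases its length. -/
theorem act_eq_or_length_lt (f : borel cs) (x : W) :
    act cs x f = x ∨ cs.length (act cs x f) < cs.length x := by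
  have key : ∀ (n : ℕ) (x : W), cs.length x = n →
      act cs x f = x ∨ cs.length (act cs x f) < cs.length x := by
    intro n
    induction n with
    | zero =>
      intro x hx
      rw [cs.length_eq_zero_iff] at hx
      exact Or.inl (by rw [hx, one_act])
    | succ n ih =>
      intro x hx
      have hx1 : x ≠ 1 := by
        intro h
        rw [cs.length_eq_zero_iff.2 h] at hx
        omega
      obtain ⟨j, hj⟩ := cs.exists_leftDescent_of_ne_one hx1
      rw [cs.isLeftDescent_iff] at hj
      have hle : cs.length (act cs (cs.simple j * x) f) ≤ n := by
        rcases ih (cs.simple j * x) (by omega) with h | h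
        · rw [h]
          omega
        · omega
      have h := biHecke_simple_mul cs f.2.1 j (cs.simple j * x)
      rw [cs.simple_mul_simple_cancel_left] at h
      change act cs x f = act cs (cs.simple j * x) f ∨
        act cs x f = cs.simple j * act cs (cs.simple j * x) f at h
      rcases h with h | h
      · right
        rw [h]
        omega
      · rcases ih (cs.simple j * x) (by omega) with h' | h'
        · left
          rw [h, h', cs.simple_mul_simple_cancel_left]
        · right
          rw [h]
          have := cs.length_mul_le (cs.simple j) (act cs (cs.simple j * x) f)
          rw [cs.length_simple] at this
          omega
  exact key _ x rfl

theorem act_mul_eq_iff (f g : borel cs) (x : W) :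
    act cs x (f * g) = x ↔ act cs x f = x ∧ act cs x g = x := by
  constructor
  · intro h
    rw [act_mul] at h
    have hf : act cs x f = x := by
      rcases act_eq_or_length_lt cs f x with h1 | h1
      · exact h1
      · rcases act_eq_or_length_lt cs g (act cs x f) with h2 | h2
        · rw [← h2, h]
        · rw [h] at h2
          omega
    exact ⟨hf, by rwa [hf] at h⟩
  · rintro ⟨hf, hg⟩
    rw [act_mul, hf, hg]

/-- When `W` is finite, the powers of every element of `M₁` stabilize. -/
theorem exists_pow_succ_eq [Finite W] (f : borel cs) : ∃ k : ℕ, 0 < k ∧ f ^ (k + 1) = f ^ k := by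
  obtain ⟨N, hN⟩ := (Set.finite_range cs.length).bddAbove
  have key : ∀ (n : ℕ) (x : W), cs.length x ≤ n → act cs (act cs x (f ^ n)) f = act cs x (f ^ n) := by
    intro n
    induction n with
    | zero =>
      intro x hx
      have : x = 1 := cs.length_eq_zero_iff.1 (by omega)
      rw [this, one_act, one_act]
    | succ n ih =>
      intro x hx
      rw [pow_succ', act_mul]
      rcases act_eq_or_length_lt cs f x with h | h
      · have hfix : ∀ m : ℕ, act cs x (f ^ m) = x := by
          intro m
          induction m with
          | zero => rw [pow_zero, act_one]
          | succ m ihm => rw [pow_succ, act_mul, ihm, h]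
        rw [h, hfix, h]
      · exact ih _ (by omega)
  refine ⟨N + 1, Nat.succ_pos _, ?_⟩
  apply Subtype.ext
  apply MulOpposite.unop_injective
  funext x
  change act cs x (f ^ (N + 1 + 1)) = act cs x (f ^ (N + 1))
  rw [pow_succ f (N + 1), act_mul]
  exact key (N + 1) x ((hN ⟨x, rfl⟩).trans (Nat.le_succ N))

open Classical in
/-- The idempotent `f^∞`: the power `f ^ k`, where `k > 0` and `f ^ (k + 1) = f ^ k`. -/
noncomputable def stablePow [Finite W] (f : borel cs) : borel cs :=
  f ^ Nat.find (exists_pow_succ_eq cs f)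

end Monoid

/-! ### The one-dimensional modules -/

section Modules

variable {B : Type u} {W : Type v} [Group W] {M : CoxeterMatrix B} (cs : CoxeterSystem M W)
variable (K : Type w) [Field K]

open Classical in
/-- The scalar by which `f ∈ M₁` acts on `S_x`: `1` if `x.f = x`, and `0` otherwise. -/
noncomputable def weight (x : W) : borel cs →* K where
  toFun f := if act cs x f = x then 1 else 0
  map_one' := by simp [act_one]
  map_mul' f g := by
    by_cases hf : act cs x f = x <;> by_cases hg : act cs x g = x <;>
      simp [act_mul_eq_iff, hf, hg]

/-- The vector space `S_x`, of dimension one with basis `ε_x = 1`. -/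
def SimpleMod (_cs : CoxeterSystem M W) (K : Type w) (_x : W) : Type w := K

noncomputable instance (x : W) : AddCommGroup (SimpleMod cs K x) :=
  inferInstanceAs (AddCommGroup K)

noncomputable instance (x : W) : Module K (SimpleMod cs K x) :=
  inferInstanceAs (Module K K)

/-- The right `K[M₁]`-module structure on `S_x`, with `f ∈ M₁` acting by `weight`. -/
noncomputable instance (x : W) : Module (MonoidAlgebra K (borel cs))ᵐᵒᵖ (SimpleMod cs K x) :=
  Module.compHom K
    (((MonoidAlgebra.lift K K (borel cs) (weight cs K x)).fromOpposite
      (fun _ _ => Commute.all _ _)) : (MonoidAlgebra K (borel cs))ᵐᵒᵖ →+* K)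

/-- The basis vector `ε_x` of `S_x`. -/
def epsilon (x : W) : SimpleMod cs K x := (1 : K)

open Classical in
theorem epsilon_smul (x : W) (f : borel cs) :
    MulOpposite.op (MonoidAlgebra.of K (borel cs) f) • epsilon cs K x =
      if act cs x f = x then epsilon cs K x else 0 := by
  change (MonoidAlgebra.lift K K (borel cs) (weight cs K x)
    (MonoidAlgebra.of K (borel cs) f)) * (1 : K) = _
  rw [MonoidAlgebra.lift_of, mul_one]
  rfl

instance (x : W) : IsScalarTower K (MonoidAlgebra K (borel cs))ᵐᵒᵖ (SimpleMod cs K x) where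
  smul_assoc k a v :=
    have key : ∀ u : K, (MonoidAlgebra.lift K K (borel cs) (weight cs K x) (k • a).unop) * u =
        k * ((MonoidAlgebra.lift K K (borel cs) (weight cs K x) a.unop) * u) := fun u => by
      rw [MulOpposite.unop_smul, map_smul, smul_eq_mul, mul_assoc]
    key v

end Modules

end BiHecke

namespace BiHecke

universe u v w

section Bruhat

variable {B : Type u} {W : Type v} [Group W] {M : CoxeterMatrix B} (cs : CoxeterSystem M W)

/-! ### Inversions and the strong exchange property -/

/-! The operators in `M` preserve Bruhat order (`BruhatLE.biHecke`), and they send each cover `x`,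
`s_j x` of left weak order to such a cover or to a single point (`biHecke_cover`). Those in `M₁` are
moreover regressive for Bruhat order, and their fixed points form a lower set of left weak order.
Hence an idempotent `e` is determined by its fixed points (`eq_of_fixed_iff`), which form the
interval below `w₀.e`, where `w₀` is the longest element (`act_eq_iff_leftLE`).

Since `w₀.g` lies above the whole image of `g` in left weak order, `g * f = g` exactly when `f`
fixes `w₀.g`; otherwise `g * f` has smaller total length. So right multiplication on `K[M₁]` is
triangular, with the characters of the `S_w` on the diagonal (`of_mul_sub_mem`). An element killed
by all characters is nilpotent, so the radical is their common kernel and the quotient is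
commutative. The same triangularity yields an eigenvector in every nonzero right module
(`exists_eigenvector`), so every simple module is some `S_w`; distinct `w` are separated by the
elements of `exists_act_eq_and_act_longest`.

Finally `f` and `f^∞` have the same fixed points, so `f^∞ - f` lies in the radical. Modulo these
differences every element is a combination of idempotents, on which the characters are jointly
injective (`eq_zero_of_weightHom_eq_zero`). -/

theorem invParity_mul (x y t : W) :
    invParity cs (x * y) t = invParity cs y t + invParity cs x (y * t * y⁻¹) := by
  classical
  obtain ⟨ω, rfl⟩ := cs.wordProd_surjective x
  obtain ⟨ω', rfl⟩ := cs.wordProd_surjective y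
  rw [invParity, map_mul]
  -- The lift is an action on `W × ZMod 2`; its second coordinate is therefore a cocycle.
  change (cs.lift ⟨parityStep cs, parityStep_isLiftable cs⟩ (cs.wordProd ω)
    (cs.lift ⟨parityStep cs, parityStep_isLiftable cs⟩ (cs.wordProd ω') (t, 0))).2 = _
  simp [invParity, lift_parityStep_wordProd]

theorem invParity_one (t : W) : invParity cs 1 t = 0 := by
  simp [invParity]; rfl

theorem length_mul_lt_of_invParity_eq_one {x t : W} (h : invParity cs x t = 1) :
    cs.length (x * t) < cs.length x := by
  classical
  obtain ⟨ω, hω, rfl⟩ := cs.exists_isReduced x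
  refine (cs.isRightInversion_of_mem_rightInvSeq hω (t := t) ?_).2
  by_contra hm
  rw [invParity, lift_parityStep_wordProd] at h
  simp [List.count_eq_zero_of_not_mem hm] at h

/-- For `t = v s v⁻¹` the cocycle rule gives three terms. Those of `v⁻¹` and `v` add up to the
parity of `v v⁻¹ = 1`, which is zero, and the term of `s` is one. -/
theorem invParity_reflection_self {t : W} (ht : cs.IsReflection t) : invParity cs t t = 1 := by
  obtain ⟨v, i, rfl⟩ := ht
  have h1 := invParity_mul cs v v⁻¹ (v * cs.simple i * v⁻¹)
  have h2 := invParity_mul cs (v * cs.simple i) v⁻¹ (v * cs.simple i * v⁻¹)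
  have h3 := invParity_mul cs v (cs.simple i) (cs.simple i)
  have h4 : invParity cs (cs.simple i) (cs.simple i) = 1 :=
    invParity_of_isRightDescent cs (by simp [CoxeterSystem.IsRightDescent])
  have h5 : v⁻¹ * (v * cs.simple i * v⁻¹) * v⁻¹⁻¹ = cs.simple i := by simp [mul_assoc]
  have h6 : cs.simple i * cs.simple i * (cs.simple i)⁻¹ = cs.simple i := by simp
  rw [h5, mul_inv_cancel, invParity_one] at h1
  rw [h5, h3, h6, h4] at h2
  rw [h2, add_left_comm, ← h1, add_zero]

/-- Passing from `x` to `x * t` flips the parity at `t`; if it were even at `x`, the converse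
applied to `x * t` would give the opposite length inequality. -/
theorem invParity_eq_one_of_length_mul_lt {x t : W} (ht : cs.IsReflection t)
    (h : cs.length (x * t) < cs.length x) : invParity cs x t = 1 := by
  have h1 := invParity_mul cs x t t
  rw [invParity_reflection_self cs ht, mul_inv_cancel_right] at h1
  by_contra h0
  have h2 : ∀ a : ZMod 2, a ≠ 1 → 1 + a = 1 := by decide
  rw [h2 _ h0] at h1
  have := length_mul_lt_of_invParity_eq_one cs h1
  rw [mul_assoc, ht.mul_self, mul_one] at this
  omega

/-! ### Bruhat order -/

/-- Right multiplication by a reflection that increases the length. -/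
def BruhatStep (x y : W) : Prop :=
  ∃ t, cs.IsReflection t ∧ y = x * t ∧ cs.length x < cs.length y

/-- The (strong) Bruhat order. -/
def BruhatLE : W → W → Prop := Relation.ReflTransGen (BruhatStep cs)

variable {cs}

theorem BruhatLE.eq_or_length_lt {x y : W} (h : BruhatLE cs x y) :
    x = y ∨ cs.length x < cs.length y := by
  induction h with
  | refl => exact Or.inl rfl
  | tail _ hs ih =>
    obtain ⟨_, _, _, hl⟩ := hs
    rcases ih with rfl | h
    · exact Or.inr hl
    · exact Or.inr (h.trans hl)

theorem BruhatLE.antisymm {x y : W} (h : BruhatLE cs x y) (h' : BruhatLE cs y x) : x = y := by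
  rcases h.eq_or_length_lt with h1 | h1
  · exact h1
  · rcases h'.eq_or_length_lt with h2 | h2
    · exact h2.symm
    · omega

theorem BruhatStep.inv {x y : W} (h : BruhatStep cs x y) : BruhatStep cs x⁻¹ y⁻¹ := by
  obtain ⟨t, ht, rfl, hl⟩ := h
  refine ⟨x * t * x⁻¹, ht.conj x, ?_, by simpa only [cs.length_inv] using hl⟩
  rw [mul_inv_rev, ht.inv]
  simp [mul_assoc]

theorem BruhatLE.inv {x y : W} (h : BruhatLE cs x y) : BruhatLE cs x⁻¹ y⁻¹ := by
  induction h with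
  | refl => exact .refl
  | tail _ hs ih => exact ih.tail hs.inv

theorem bruhatStep_mul_simple {x : W} {i : B} (h : ¬ cs.IsRightDescent x i) :
    BruhatStep cs x (x * cs.simple i) :=
  ⟨_, cs.isReflection_simple i, rfl, by rw [(cs.not_isRightDescent_iff).1 h]; omega⟩

theorem bruhatStep_mul_simple_of_isRightDescent {x : W} {i : B} (h : cs.IsRightDescent x i) :
    BruhatStep cs (x * cs.simple i) x :=
  ⟨_, cs.isReflection_simple i, by simp, h⟩

theorem conj_simple_eq (x t : W) (i : B) :
    x * t * cs.simple i = x * cs.simple i * (cs.simple i * t * (cs.simple i)⁻¹) := by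
  simp [mul_assoc]

/-- Lifting property of Bruhat steps. -/
theorem BruhatStep.lifting {x t : W} {i : B} (ht : cs.IsReflection t)
    (hl : cs.length x < cs.length (x * t)) (hti : t ≠ cs.simple i) :
    BruhatStep cs (x * cs.simple i) (x * t * cs.simple i) := by
  refine ⟨_, ht.conj (cs.simple i), conj_simple_eq x t i, ?_⟩
  have h1 : invParity cs (x * t) t = 1 := by
    apply invParity_eq_one_of_length_mul_lt cs ht
    rwa [mul_assoc x t t, ht.mul_self, mul_one]
  -- As `t ≠ s`, the factor `s` contributes nothing at `t`, so the inversion `t` of `x t` becomes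
  -- the inversion `s t s` of `x t s`.
  have h2 := invParity_mul cs (x * t * cs.simple i) (cs.simple i) t
  rw [cs.simple_mul_simple_cancel_right, h1] at h2
  have h3 : invParity cs (cs.simple i) t = 0 := by
    have h4 := invParity_simple_mul cs i 1 t
    rw [mul_one, invParity_one, one_mul, inv_one, mul_one, if_neg hti, add_zero] at h4
    exact h4
  rw [h3, zero_add] at h2
  have h5 := length_mul_lt_of_invParity_eq_one cs h2.symm
  have h6 : x * t * cs.simple i * (cs.simple i * t * (cs.simple i)⁻¹) = x * cs.simple i := by
    rw [← conj_simple_eq, mul_assoc x t t, ht.mul_self, mul_one]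
  rwa [h6] at h5

/-- The delicate case is an ascent at `x` and a descent at `x t`: either `t = s` and the images
coincide, or lifting gives `x s < x t s < x t`. -/
theorem BruhatStep.antisort {x y : W} (h : BruhatStep cs x y) (i : B) :
    BruhatLE cs (antisort cs i x) (antisort cs i y) := by
  obtain ⟨t, ht, rfl, hl⟩ := h
  unfold BiHecke.antisort
  by_cases h1 : cs.IsRightDescent x i <;> by_cases h2 : cs.IsRightDescent (x * t) i
  · rw [if_pos h1, if_pos h2]
    exact .single ⟨t, ht, rfl, hl⟩
  · rw [if_pos h1, if_neg h2]
    exact .tail (.single ⟨t, ht, rfl, hl⟩) (bruhatStep_mul_simple h2)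
  · rw [if_neg h1, if_pos h2]
    by_cases hti : t = cs.simple i
    · rw [hti]
      exact .refl
    · exact .tail (.single (lifting ht hl hti)) (bruhatStep_mul_simple_of_isRightDescent h2)
  · rw [if_neg h1, if_neg h2]
    refine .single ⟨_, ht.conj (cs.simple i), conj_simple_eq x t i, ?_⟩
    rw [(cs.not_isRightDescent_iff).1 h1, (cs.not_isRightDescent_iff).1 h2]
    omega

theorem BruhatLE.antisort {x y : W} (h : BruhatLE cs x y) (i : B) :
    BruhatLE cs (antisort cs i x) (antisort cs i y) := by
  induction h with
  | refl => exact .refl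
  | tail _ hs ih => exact ih.trans (hs.antisort i)

theorem BruhatStep.sort {x y : W} (h : BruhatStep cs x y) (i : B) :
    BruhatLE cs (sort cs i x) (sort cs i y) := by
  obtain ⟨t, ht, rfl, hl⟩ := h
  unfold BiHecke.sort
  by_cases h1 : cs.IsRightDescent x i <;> by_cases h2 : cs.IsRightDescent (x * t) i
  · rw [if_pos h1, if_pos h2]
    refine .single ⟨_, ht.conj (cs.simple i), conj_simple_eq x t i, ?_⟩
    have e1 := (cs.isRightDescent_iff).1 h1
    have e2 := (cs.isRightDescent_iff).1 h2
    omega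
  · rw [if_pos h1, if_neg h2]
    exact .tail (.single (bruhatStep_mul_simple_of_isRightDescent h1)) ⟨t, ht, rfl, hl⟩
  · rw [if_neg h1, if_pos h2]
    by_cases hti : t = cs.simple i
    · rw [hti, cs.simple_mul_simple_cancel_right]
      exact .refl
    · exact .head (bruhatStep_mul_simple h1) (.single (lifting ht hl hti))
  · rw [if_neg h1, if_neg h2]
    exact .single ⟨t, ht, rfl, hl⟩

theorem BruhatLE.sort {x y : W} (h : BruhatLE cs x y) (i : B) :
    BruhatLE cs (sort cs i x) (sort cs i y) := by
  induction h with
  | refl => exact .refl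
  | tail _ hs ih => exact ih.trans (hs.sort i)

theorem BruhatLE.biHecke {f : (Function.End W)ᵐᵒᵖ} (hf : f ∈ biHecke cs) {x y : W}
    (h : BruhatLE cs x y) : BruhatLE cs (f.unop x) (f.unop y) := by
  induction hf using Submonoid.closure_induction generalizing x y with
  | one => exact h
  | mul f g _ _ ihf ihg => exact ihg (ihf h)
  | mem f hf =>
    rcases hf with ⟨i, rfl⟩ | ⟨i, rfl⟩
    · exact h.antisort i
    · exact h.sort i

/-- Inversion preserves Bruhat order and turns left multiplication at ascents into antisorting,
which is monotone. -/
theorem BruhatLE.simple_mul {x y : W} (h : BruhatLE cs x y) {j : B}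
    (hx : ¬ cs.IsLeftDescent x j) (hy : ¬ cs.IsLeftDescent y j) :
    BruhatLE cs (cs.simple j * x) (cs.simple j * y) := by
  rw [← cs.isRightDescent_inv_iff] at hx hy
  have := (h.inv.antisort j).inv
  unfold BiHecke.antisort at this
  simpa [hx, hy] using this

/-! ### Left weak order -/

variable (cs)

/-- The left weak order. -/
def LeftLE : W → W → Prop :=
  Relation.ReflTransGen (fun x y => ∃ j, ¬ cs.IsLeftDescent x j ∧ y = cs.simple j * x)

variable {cs}

theorem LeftLE.eq_or_length_lt {x y : W} (h : LeftLE cs x y) :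
    x = y ∨ cs.length x < cs.length y := by
  induction h with
  | refl => exact Or.inl rfl
  | tail _ hs ih =>
    obtain ⟨j, hj, rfl⟩ := hs
    have := (cs.not_isLeftDescent_iff).1 hj
    rcases ih with rfl | h
    · exact Or.inr (by omega)
    · exact Or.inr (by omega)

theorem LeftLE.antisymm {x y : W} (h : LeftLE cs x y) (h' : LeftLE cs y x) : x = y := by
  rcases h.eq_or_length_lt with h1 | h1
  · exact h1
  · rcases h'.eq_or_length_lt with h2 | h2
    · exact h2.symm
    · omega

theorem LeftLE.one_le (x : W) : LeftLE cs 1 x := by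
  induction hn : cs.length x generalizing x with
  | zero =>
    rw [cs.length_eq_zero_iff.1 hn]
    exact .refl
  | succ n ih =>
    have hx : x ≠ 1 := fun h => by simp [h] at hn
    obtain ⟨j, hj⟩ := cs.exists_leftDescent_of_ne_one hx
    have h1 := (cs.isLeftDescent_iff).1 hj
    exact .tail (ih (cs.simple j * x) (by omega))
      ⟨j, (cs.isLeftDescent_iff_not_isLeftDescent_mul).1 hj, by simp⟩

/-- Right multiplication by `s_i` changes the lengths of `x` and `s_j x` by the same amount, so
their comparison is unaffected. -/
theorem isLeftDescent_mul_simple_iff {x : W} {i j : B}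
    (h : cs.IsRightDescent (cs.simple j * x) i ↔ cs.IsRightDescent x i) :
    cs.IsLeftDescent (x * cs.simple i) j ↔ cs.IsLeftDescent x j := by
  unfold CoxeterSystem.IsLeftDescent
  rw [← mul_assoc]
  by_cases hx : cs.IsRightDescent x i
  · have h1 := (cs.isRightDescent_iff).1 hx
    have h2 := (cs.isRightDescent_iff).1 (h.2 hx)
    omega
  · have h1 := (cs.not_isRightDescent_iff).1 hx
    have h2 := (cs.not_isRightDescent_iff).1 (fun h' => hx (h.1 h'))
    omega

/-- The elements of the biHecke monoid preserve or collapse the covers of left weak order. -/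
theorem biHecke_cover {f : (Function.End W)ᵐᵒᵖ} (hf : f ∈ biHecke cs) {j : B} {x : W}
    (hx : ¬ cs.IsLeftDescent x j) :
    f.unop (cs.simple j * x) = f.unop x ∨
      f.unop (cs.simple j * x) = cs.simple j * f.unop x ∧ ¬ cs.IsLeftDescent (f.unop x) j := by
  induction hf using Submonoid.closure_induction generalizing x with
  | one => exact Or.inr ⟨rfl, hx⟩
  | mul f g _ _ ihf ihg =>
    change g.unop (f.unop (cs.simple j * x)) = g.unop (f.unop x) ∨
      g.unop (f.unop (cs.simple j * x)) = cs.simple j * g.unop (f.unop x) ∧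
        ¬ cs.IsLeftDescent (g.unop (f.unop x)) j
    rcases ihf hx with h | ⟨h, h'⟩
    · exact Or.inl (by rw [h])
    · rw [h]
      exact ihg h'
  | mem f hf =>
    rcases hf with ⟨i, rfl⟩ | ⟨i, rfl⟩
    · change antisort cs i (cs.simple j * x) = antisort cs i x ∨
        antisort cs i (cs.simple j * x) = cs.simple j * antisort cs i x ∧
          ¬ cs.IsLeftDescent (antisort cs i x) j
      -- If the descents at `i` disagree, then `s_j x = x s_i`, and the operator sends both ends of
      -- the cover to the same element.
      have key := @simple_mul_eq_of_descent_ne _ _ _ _ cs j i x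
      unfold antisort
      by_cases h1 : cs.IsRightDescent (cs.simple j * x) i <;> by_cases h2 : cs.IsRightDescent x i
      · simp [h1, h2, hx]
      · left
        rw [if_pos h1, if_neg h2]
        exact key (by simp [h1, h2])
      · left
        rw [if_neg h1, if_pos h2, key (by simp [h1, h2])]
        simp
      · rw [if_neg h1, if_neg h2, isLeftDescent_mul_simple_iff (by simp [h1, h2])]
        exact Or.inr ⟨mul_assoc _ _ _, hx⟩
    · change sort cs i (cs.simple j * x) = sort cs i x ∨
        sort cs i (cs.simple j * x) = cs.simple j * sort cs i x ∧
          ¬ cs.IsLeftDescent (sort cs i x) j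
      have key := @simple_mul_eq_of_descent_ne _ _ _ _ cs j i x
      unfold sort
      by_cases h1 : cs.IsRightDescent (cs.simple j * x) i <;> by_cases h2 : cs.IsRightDescent x i
      · rw [if_pos h1, if_pos h2, isLeftDescent_mul_simple_iff (by simp [h1, h2])]
        exact Or.inr ⟨mul_assoc _ _ _, hx⟩
      · left
        rw [if_pos h1, if_neg h2, key (by simp [h1, h2])]
        simp
      · left
        rw [if_neg h1, if_pos h2]
        exact key (by simp [h1, h2])
      · simp [h1, h2, hx]

theorem LeftLE.biHecke {f : (Function.End W)ᵐᵒᵖ} (hf : f ∈ biHecke cs) {x y : W}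
    (h : LeftLE cs x y) : LeftLE cs (f.unop x) (f.unop y) := by
  induction h with
  | refl => exact .refl
  | tail _ hs ih =>
    obtain ⟨j, hj, rfl⟩ := hs
    rcases biHecke_cover hf hj with h | ⟨h, h'⟩
    · rwa [h]
    · exact ih.tail ⟨j, h', h⟩

theorem LeftLE.act {x y : W} (h : LeftLE cs x y) (f : borel cs) :
    LeftLE cs (act cs x f) (act cs y f) := h.biHecke f.2.1

/-- The set of fixed points of an element of `M₁` is a lower set of left weak order. -/
theorem LeftLE.act_eq {f : borel cs} {x y : W} (h : LeftLE cs x y) (hy : BiHecke.act cs y f = y) :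
    BiHecke.act cs x f = x := by
  induction h with
  | refl => exact hy
  | @tail u y _ hs ih =>
    obtain ⟨j, hj, rfl⟩ := hs
    refine ih ((act_eq_or_length_lt cs f u).resolve_right fun hlt => ?_)
    have h1 := (cs.not_isLeftDescent_iff).1 hj
    -- A collapsed cover would give `u.f = s_j u`, longer than `u`; a preserved one cancels to `u.f
    -- = u`. Both contradict `hlt`.
    rcases biHecke_simple_mul cs f.2.1 j u with h2 | h2
    · change BiHecke.act cs (cs.simple j * u) f = BiHecke.act cs u f at h2
      rw [← h2, hy] at hlt
      omega
    · change BiHecke.act cs (cs.simple j * u) f = cs.simple j * BiHecke.act cs u f at h2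
      rw [hy] at h2
      rw [← mul_left_cancel h2] at hlt
      omega

/-- The elements of `M₁` are regressive for Bruhat order. -/
theorem act_bruhatLE (f : borel cs) (x : W) : BruhatLE cs (act cs x f) x := by
  have h := LeftLE.one_le (cs := cs) x
  induction h with
  | refl =>
    rw [one_act]
    exact .refl
  | @tail u y _ hs ih =>
    obtain ⟨j, hj, rfl⟩ := hs
    have hstep : BruhatLE cs u (cs.simple j * u) := by
      rw [← cs.isRightDescent_inv_iff] at hj
      have := (bruhatStep_mul_simple hj).inv
      simp only [inv_inv, mul_inv_rev, cs.inv_simple] at this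
      exact .single this
    rcases biHecke_cover f.2.1 hj with h | ⟨h, h'⟩
    · change act cs (cs.simple j * u) f = act cs u f at h
      rw [h]
      exact ih.trans hstep
    · change act cs (cs.simple j * u) f = cs.simple j * act cs u f at h
      rw [h]
      exact ih.simple_mul h' hj

/-! ### Idempotents are determined by their fixed points -/

@[ext]
theorem borel_ext {f g : borel cs} (h : ∀ x, act cs x f = act cs x g) : f = g :=
  Subtype.ext (MulOpposite.unop_injective (funext h))

theorem act_act_of_isIdempotentElem {e : borel cs} (he : IsIdempotentElem e) (x : W) :
    act cs (act cs x e) e = act cs x e := by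
  rw [← act_mul, he]

/-- The point `x.e` is fixed by `e'` and lies below `x`, so applying the monotone `e'` gives `x.e ≤
x.e'` in Bruhat order; the situation is symmetric. -/
theorem eq_of_fixed_iff {e e' : borel cs} (he : IsIdempotentElem e) (he' : IsIdempotentElem e')
    (h : ∀ x, act cs x e = x ↔ act cs x e' = x) : e = e' := by
  ext x
  have h1 : act cs (act cs x e) e' = act cs x e := (h _).1 (act_act_of_isIdempotentElem he x)
  have h2 : act cs (act cs x e') e = act cs x e' := (h _).2 (act_act_of_isIdempotentElem he' x)
  have h3 := (act_bruhatLE e x).biHecke e'.2.1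
  have h4 := (act_bruhatLE e' x).biHecke e.2.1
  change BruhatLE cs (act cs (act cs x e) e') (act cs x e') at h3
  change BruhatLE cs (act cs (act cs x e') e) (act cs x e) at h4
  rw [h1] at h3
  rw [h2] at h4
  exact h3.antisymm h4

end Bruhat

/-! ### The longest element and the idempotents of `M₁` -/

section Longest

variable {B : Type u} {W : Type v} [Group W] {M : CoxeterMatrix B} {cs : CoxeterSystem M W}

theorem antisort_mem (i : B) : @MulOpposite.op (Function.End W) (antisort cs i) ∈ biHecke cs :=
  Submonoid.subset_closure (Or.inl ⟨i, rfl⟩)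

theorem sort_mem (i : B) : @MulOpposite.op (Function.End W) (sort cs i) ∈ biHecke cs :=
  Submonoid.subset_closure (Or.inr ⟨i, rfl⟩)

/-- Every element is reached from `1` by antisorting operators, which fix each element that has
all right descents. -/
theorem exists_antisort_path (x : W) : ∃ f ∈ biHecke cs, f.unop 1 = x ∧
    ∀ y, (∀ i, cs.IsRightDescent y i) → f.unop y = y := by
  induction hn : cs.length x generalizing x with
  | zero => exact ⟨1, one_mem _, (cs.length_eq_zero_iff.1 hn).symm, fun _ _ => rfl⟩
  | succ n ih =>
    have hx : x ≠ 1 := fun h => by simp [h] at hn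
    obtain ⟨i, hi⟩ := cs.exists_rightDescent_of_ne_one hx
    have h1 := (cs.isRightDescent_iff).1 hi
    obtain ⟨f, hf, hf1, hf2⟩ := ih (x * cs.simple i) (by omega)
    refine ⟨f * @MulOpposite.op (Function.End W) (antisort cs i), mul_mem hf (antisort_mem i),
      ?_, fun y hy => ?_⟩
    · change antisort cs i (f.unop 1) = x
      rw [hf1, antisort, if_neg ((cs.isRightDescent_iff_not_isRightDescent_mul).1 hi)]
      simp
    · change antisort cs i (f.unop y) = y
      rw [hf2 y hy, antisort, if_pos (hy i)]

variable [Finite W]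

variable (cs) in
theorem exists_length_max : ∃ m : W, ∀ x, cs.length x ≤ cs.length m :=
  Finite.exists_max cs.length

variable (cs) in
/-- The longest element. -/
noncomputable def longest : W := (exists_length_max cs).choose

theorem length_le_longest (x : W) : cs.length x ≤ cs.length (longest cs) :=
  (exists_length_max cs).choose_spec x

theorem isRightDescent_of_length_max {y : W} (h : cs.length y = cs.length (longest cs)) (i : B) :
    cs.IsRightDescent y i := by
  by_contra hi
  have h1 := (cs.not_isRightDescent_iff).1 hi
  have h2 := length_le_longest (cs := cs) (y * cs.simple i)
  omega

/-- A product of antisorting operators leading from `1` to `w₀` fixes `y`; applied to `1 ≤ y` in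
left weak order it gives `w₀ ≤ y`. -/
theorem eq_longest_of_forall_isRightDescent {y : W} (h : ∀ i, cs.IsRightDescent y i) :
    y = longest cs := by
  obtain ⟨f, hf, hf1, hf2⟩ := exists_antisort_path (cs := cs) (longest cs)
  have h1 := (LeftLE.one_le (cs := cs) y).biHecke hf
  rw [hf1, hf2 y h] at h1
  rcases h1.eq_or_length_lt with h2 | h2
  · exact h2.symm
  · exact absurd (length_le_longest (cs := cs) y) (by omega)

theorem longest_inv : (longest cs)⁻¹ = longest cs :=
  eq_longest_of_forall_isRightDescent fun i =>
    isRightDescent_of_length_max (cs.length_inv _) i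

theorem leftLE_longest (x : W) : LeftLE cs x (longest cs) := by
  induction hn : cs.length (longest cs) - cs.length x using Nat.strong_induction_on
    generalizing x with
  | _ n ih =>
    by_cases h : ∀ j, cs.IsLeftDescent x j
    · have : x⁻¹ = longest cs :=
        eq_longest_of_forall_isRightDescent fun i => (cs.isRightDescent_inv_iff).2 (h i)
      rw [← longest_inv, ← this, inv_inv]
      exact .refl
    · push Not at h
      obtain ⟨j, hj⟩ := h
      have h1 := (cs.not_isLeftDescent_iff).1 hj
      have h2 := length_le_longest (cs := cs) (cs.simple j * x)
      exact .head ⟨j, hj, rfl⟩ (ih _ (by omega) _ rfl)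

theorem act_leftLE_act_longest (f : borel cs) (x : W) :
    LeftLE cs (act cs x f) (act cs (longest cs) f) := (leftLE_longest x).act f

/-- The set of fixed points of an idempotent `e` of `M₁` is the left weak order interval below
`w₀.e`. -/
theorem act_eq_iff_leftLE {e : borel cs} (he : IsIdempotentElem e) (x : W) :
    act cs x e = x ↔ LeftLE cs x (act cs (longest cs) e) := by
  refine ⟨fun h => ?_, fun h => h.act_eq (act_act_of_isIdempotentElem he _)⟩
  rw [← h]
  exact act_leftLE_act_longest e x

theorem act_longest_injective {e e' : borel cs} (he : IsIdempotentElem e)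
    (he' : IsIdempotentElem e') (h : act cs (longest cs) e = act cs (longest cs) e') : e = e' :=
  eq_of_fixed_iff he he' fun x => by rw [act_eq_iff_leftLE he, act_eq_iff_leftLE he', h]

/-- Descending induction from `w₀`: if `e` serves for `w s_i > w`, then `π_i e π̄_i` serves for `w`.
-/
theorem exists_act_eq_and_act_longest (w : W) :
    ∃ e : borel cs, act cs w e = w ∧ act cs (longest cs) e = w := by
  induction hn : cs.length (longest cs) - cs.length w using Nat.strong_induction_on
    generalizing w with
  | _ n ih =>
    by_cases h : ∀ i, cs.IsRightDescent w i
    · exact ⟨1, rfl, (eq_longest_of_forall_isRightDescent h).symm⟩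
    · push Not at h
      obtain ⟨i, hi⟩ := h
      have h1 := (cs.not_isRightDescent_iff).1 hi
      have h2 := length_le_longest (cs := cs) (w * cs.simple i)
      obtain ⟨e, he1, he2⟩ := ih _ (by omega) (w * cs.simple i) rfl
      have ha : antisort cs i w = w * cs.simple i := by rw [antisort, if_neg hi]
      have ha1 : antisort cs i 1 = cs.simple i := by
        rw [antisort, if_neg (cs.not_isRightDescent_one i), one_mul]
      have hb : sort cs i (w * cs.simple i) = w := by
        have : cs.IsRightDescent (w * cs.simple i) i := by
          rw [cs.isRightDescent_iff_not_isRightDescent_mul]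
          simpa using hi
        rw [sort, if_pos this]
        simp
      have hb1 : sort cs i (cs.simple i) = 1 := by
        have : cs.IsRightDescent (cs.simple i) i := by simp [CoxeterSystem.IsRightDescent]
        rw [sort, if_pos this]
        simp
      -- Needed for membership in `M₁`: `1.π_i = s_i` lies below the fixed point `w s_i` of `e`,
      -- hence is fixed by `e` and then sorted back to `1`.
      have hle : LeftLE cs (cs.simple i) (w * cs.simple i) := by
        have := (LeftLE.one_le (cs := cs) w).biHecke (antisort_mem (cs := cs) i)
        change LeftLE cs (antisort cs i 1) (antisort cs i w) at this
        rwa [ha, ha1] at this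
      have hm : antisort cs i (longest cs) = longest cs := by
        rw [antisort, if_pos (isRightDescent_of_length_max rfl i)]
      refine ⟨⟨@MulOpposite.op (Function.End W) (antisort cs i) * e.1 *
        @MulOpposite.op (Function.End W) (sort cs i),
        mul_mem (mul_mem (antisort_mem i) e.2.1) (sort_mem i), ?_⟩, ?_, ?_⟩
      · change sort cs i (act cs (antisort cs i 1) e) = 1
        rw [ha1, hle.act_eq he1, hb1]
      · change sort cs i (act cs (antisort cs i w) e) = w
        rw [ha, he1, hb]
      · change sort cs i (act cs (antisort cs i (longest cs)) e) = w
        rw [hm, he2, hb]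

/-- Elements of `W` are separated by the sets of elements of `M₁` that fix them. -/
theorem eq_of_act_eq_iff {w w' : W} (h : ∀ f : borel cs, act cs w f = w ↔ act cs w' f = w') :
    w = w' := by
  have key : ∀ {w w' : W}, (∀ f : borel cs, act cs w f = w ↔ act cs w' f = w') →
      LeftLE cs w' w := by
    intro w w' h
    -- By hypothesis `e` also fixes `w'`, so `w' = w'.e ≤ w₀.e = w`.
    obtain ⟨e, he1, he2⟩ := exists_act_eq_and_act_longest (cs := cs) w
    have := act_leftLE_act_longest e w'
    rwa [he2, (h e).1 he1] at this
  exact (key fun f => (h f).symm).antisymm (key h)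

end Longest

/-! ### The algebra of `M₁` -/

section Algebra

variable {B : Type u} {W : Type v} [Group W] {M : CoxeterMatrix B} {cs : CoxeterSystem M W}
  {K : Type w} [Field K]

variable (cs K) in
/-- The linear character of `K[M₁]` afforded by `S_x`. -/
noncomputable def weightHom (x : W) : MonoidAlgebra K (borel cs) →ₐ[K] K :=
  MonoidAlgebra.lift K K (borel cs) (weight cs K x)

open Classical in
theorem weightHom_of (x : W) (f : borel cs) :
    weightHom cs K x (MonoidAlgebra.of K (borel cs) f) = if act cs x f = x then 1 else 0 := by
  rw [weightHom, MonoidAlgebra.lift_of]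
  rfl

theorem smul_simpleMod (x : W) (a : (MonoidAlgebra K (borel cs))ᵐᵒᵖ) (c : SimpleMod cs K x) :
    a • c = weightHom cs K x a.unop • c := rfl

variable [Finite W]

/-! ### Stable powers -/

theorem isIdempotentElem_stablePow (f : borel cs) : IsIdempotentElem (stablePow cs f) := by
  classical
  unfold stablePow
  set k := Nat.find (exists_pow_succ_eq cs f)
  have h : f ^ (k + 1) = f ^ k := (Nat.find_spec (exists_pow_succ_eq cs f)).2
  have key : ∀ n, f ^ (k + n) = f ^ k := by
    intro n
    induction n with
    | zero => rfl
    | succ n ih => rw [← add_assoc, pow_succ, ih, ← pow_succ, h]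
  rw [IsIdempotentElem, ← pow_add, key]

theorem act_stablePow_eq_iff (f : borel cs) (x : W) :
    act cs x (stablePow cs f) = x ↔ act cs x f = x := by
  classical
  unfold stablePow
  -- Positivity of the exponent matters: `f ^ 0` fixes everything.
  obtain ⟨n, hn⟩ := Nat.exists_eq_succ_of_ne_zero
    (Nat.find_spec (exists_pow_succ_eq cs f)).1.ne'
  rw [hn]
  clear hn
  induction n with
  | zero => rw [Nat.succ_eq_add_one, zero_add, pow_one]
  | succ n ih => rw [Nat.succ_eq_add_one, pow_succ, act_mul_eq_iff, ih, and_self]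

theorem stablePow_eq_self {f : borel cs} (hf : IsIdempotentElem f) : stablePow cs f = f :=
  eq_of_fixed_iff (isIdempotentElem_stablePow f) hf (act_stablePow_eq_iff f)

/-- The sum of the lengths of the values of an element of `M₁`. -/
noncomputable def totalLength (g : borel cs) : ℕ :=
  letI := Fintype.ofFinite W
  ∑ x, cs.length (act cs x g)

/-- The image of `g` lies below `w₀.g` in left weak order, and the fixed points of `f` form a lower
set. -/
theorem mul_eq_left_iff (g f : borel cs) :
    g * f = g ↔ act cs (act cs (longest cs) g) f = act cs (longest cs) g := by
  refine ⟨fun h => by rw [← act_mul, h], fun h => ?_⟩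
  ext x
  exact (act_leftLE_act_longest g x).act_eq h

theorem totalLength_mul_lt {g f : borel cs} (h : g * f ≠ g) :
    totalLength (g * f) < totalLength g := by
  let _ := Fintype.ofFinite W
  have key : ∀ x, act cs x (g * f) = act cs x g ∨
      cs.length (act cs x (g * f)) < cs.length (act cs x g) := fun x =>
    act_eq_or_length_lt cs f (act cs x g)
  refine Finset.sum_lt_sum (fun x _ => ?_) ?_
  · rcases key x with h | h
    · rw [h]
    · exact h.le
  · by_contra! hc
    refine h (borel_ext fun x => (key x).resolve_right ?_)
    exact (hc x (Finset.mem_univ x)).not_gt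

variable (cs K) in
/-- The span of the elements of `M₁` of total length less than `n`. -/
noncomputable def lengthFiltration (n : ℕ) : Submodule K (MonoidAlgebra K (borel cs)) :=
  Submodule.span K (MonoidAlgebra.of K (borel cs) '' {h | totalLength h < n})

/-- Right multiplication is triangular, with diagonal entries given by the characters. -/
theorem of_mul_sub_mem (g : borel cs) (a : MonoidAlgebra K (borel cs)) :
    MonoidAlgebra.of K (borel cs) g * a -
      weightHom cs K (act cs (longest cs) g) a • MonoidAlgebra.of K (borel cs) g ∈
        lengthFiltration cs K (totalLength g) := by
  induction a using MonoidAlgebra.induction_on with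
  | of f =>
    rw [weightHom_of, ← map_mul]
    by_cases h : g * f = g
    · rw [if_pos ((mul_eq_left_iff g f).1 h), one_smul, h, sub_self]
      exact zero_mem _
    · rw [if_neg (fun h' => h ((mul_eq_left_iff g f).2 h')), zero_smul, sub_zero]
      exact Submodule.subset_span ⟨_, totalLength_mul_lt h, rfl⟩
  | add a b ha hb =>
    rw [mul_add, map_add, add_smul, add_sub_add_comm]
    exact add_mem ha hb
  | smul c a ha =>
    rw [mul_smul_comm, map_smul, smul_assoc, ← smul_sub]
    exact Submodule.smul_mem _ c ha

/-- The diagonal entries vanish, so only the strictly triangular part of right multiplication by `a`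
remains. -/
theorem mul_mem_lengthFiltration {a : MonoidAlgebra K (borel cs)}
    (ha : ∀ x, weightHom cs K x a = 0) {n : ℕ} {b : MonoidAlgebra K (borel cs)}
    (hb : b ∈ lengthFiltration cs K (n + 1)) : b * a ∈ lengthFiltration cs K n := by
  induction hb using Submodule.span_induction with
  | mem b hb =>
    obtain ⟨g, hg, rfl⟩ := hb
    have h := of_mul_sub_mem g a
    rw [ha, zero_smul, sub_zero] at h
    refine Submodule.span_mono (Set.image_mono fun f hf => ?_) h
    exact lt_of_lt_of_le hf (Nat.le_of_lt_succ hg)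
  | zero => rw [zero_mul]; exact zero_mem _
  | add b c _ _ hb hc => rw [add_mul]; exact add_mem hb hc
  | smul r b _ hb => rw [smul_mul_assoc]; exact Submodule.smul_mem _ r hb

theorem isNilpotent_of_weightHom_eq_zero {a : MonoidAlgebra K (borel cs)}
    (ha : ∀ x, weightHom cs K x a = 0) : IsNilpotent a := by
  have key : ∀ n, ∀ b ∈ lengthFiltration cs K n, b * a ^ n = 0 := by
    intro n
    induction n with
    | zero =>
      intro b hb
      have h0 : {h : borel cs | totalLength h < 0} = ∅ := by simp
      rw [lengthFiltration, h0, Set.image_empty, Submodule.span_empty, Submodule.mem_bot] at hb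
      rw [hb, zero_mul]
    | succ n ih =>
      intro b hb
      rw [pow_succ', ← mul_assoc]
      exact ih _ (mul_mem_lengthFiltration ha hb)
  refine ⟨totalLength (1 : borel cs) + 1, ?_⟩
  rw [← one_mul (a ^ _)]
  exact key _ _ (Submodule.subset_span ⟨1, Nat.lt_succ_self _, map_one _⟩)

/-- The Jacobson radical is the common kernel of the characters. -/
theorem mem_jacobson_iff_weightHom (a : MonoidAlgebra K (borel cs)) :
    a ∈ Ring.jacobson (MonoidAlgebra K (borel cs)) ↔ ∀ x, weightHom cs K x a = 0 := by
  constructor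
  · intro ha x
    let φ : MonoidAlgebra K (borel cs) →+* K := weightHom cs K x
    have : RingHomSurjective φ := ⟨fun c => ⟨algebraMap K _ c, (weightHom cs K x).commutes c⟩⟩
    -- A surjective character maps the radical into the radical of the field `K`, which is zero.
    have h := Ring.le_comap_jacobson φ ha
    rw [IsSemisimpleRing.jacobson_eq_bot] at h
    exact h
  · intro ha
    rw [← Ideal.jacobson_bot, Ideal.mem_jacobson_iff]
    intro y
    have hn : IsNilpotent (y * a) :=
      isNilpotent_of_weightHom_eq_zero fun x => by rw [map_mul, ha, mul_zero]
    obtain ⟨z, hz⟩ := hn.isUnit_add_one.exists_left_inv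
    refine ⟨z, ?_⟩
    rw [mul_add, mul_one, ← mul_assoc] at hz
    rw [hz, sub_self]
    exact zero_mem _

/-! ### The basis of the radical -/

/-- Take `e` in the support with `w₀.e` of maximal length. An `f` in the support that fixes `w₀.e`
has `w₀.e ≤ w₀.f`, so maximality forces `f = e`; the character at `w₀.e` thus reads off the
coefficient of `e`. -/
theorem eq_zero_of_weightHom_eq_zero {b : MonoidAlgebra K (borel cs)}
    (hb : ∀ f, ¬ IsIdempotentElem f → b.coeff f = 0) (h : ∀ x, weightHom cs K x b = 0) :
    b = 0 := by
  classical
  by_contra hne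
  have hs : b.coeff.support.Nonempty := by
    rw [Finsupp.support_nonempty_iff]
    simpa using hne
  obtain ⟨e, he, hmax⟩ := b.coeff.support.exists_max_image
    (fun f => cs.length (act cs (longest cs) f)) hs
  have hidem : ∀ f ∈ b.coeff.support, IsIdempotentElem f := fun f hf => by
    by_contra hf'
    exact Finsupp.mem_support_iff.1 hf (hb f hf')
  have h1 := h (act cs (longest cs) e)
  rw [weightHom, MonoidAlgebra.lift_apply, Finsupp.sum, Finset.sum_eq_single_of_mem e he] at h1
  · rw [Finsupp.mem_support_iff] at he
    refine he ?_
    simpa [weight, act_act_of_isIdempotentElem (hidem e (Finsupp.mem_support_iff.2 he))] using h1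
  · intro f hf hfe
    have : ¬ act cs (act cs (longest cs) e) f = act cs (longest cs) e := by
      rw [act_eq_iff_leftLE (hidem f hf)]
      intro hle
      rcases hle.eq_or_length_lt with h2 | h2
      · exact hfe (act_longest_injective (hidem f hf) (hidem e he) h2.symm)
      · exact (hmax f hf).not_gt h2
    simp [weight, this]

variable (cs K) in
/-- The family `f^∞ - f`, for `f` not idempotent. -/
noncomputable def stableDiff (f : {f : borel cs // ¬ IsIdempotentElem f}) :
    MonoidAlgebra K (borel cs) :=
  MonoidAlgebra.of K (borel cs) (stablePow cs f.1) - MonoidAlgebra.of K (borel cs) f.1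

/-- At a non-idempotent `g` the idempotent terms contribute nothing, so the coefficient there is `-c
g`. -/
theorem linearIndependent_stableDiff : LinearIndependent K (stableDiff cs K) := by
  classical
  rw [linearIndependent_iff']
  intro s c hc g hg
  have h := congrArg (fun a => MonoidAlgebra.coeff a g.1) hc
  simp only [MonoidAlgebra.coeff_sum, Finsupp.finsetSum_apply, MonoidAlgebra.coeff_smul_apply,
    stableDiff] at h
  rw [Finset.sum_eq_single_of_mem g hg] at h
  · have h1 : stablePow cs g.1 ≠ g.1 := fun h' => g.2 (h' ▸ isIdempotentElem_stablePow g.1)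
    simpa [MonoidAlgebra.of_apply, h1, Finsupp.single_apply] using h
  · intro f _ hfg
    have h1 : stablePow cs f.1 ≠ g.1 := fun h' => g.2 (h' ▸ isIdempotentElem_stablePow f.1)
    have h2 : f.1 ≠ g.1 := fun h' => hfg (Subtype.ext h')
    simp [MonoidAlgebra.of_apply, h1, h2]

theorem weightHom_eq_zero_of_mem_span {a : MonoidAlgebra K (borel cs)}
    (ha : a ∈ Submodule.span K (Set.range (stableDiff cs K))) (x : W) :
    weightHom cs K x a = 0 := by
  classical
  induction ha using Submodule.span_induction with
  | mem a ha =>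
    obtain ⟨f, rfl⟩ := ha
    simp only [stableDiff, map_sub, weightHom_of, act_stablePow_eq_iff, sub_self]
  | zero => exact map_zero _
  | add a b _ _ ha hb => rw [map_add, ha, hb, add_zero]
  | smul r a _ ha => rw [map_smul, ha, smul_zero]

/-- Replace each `f` in `a` by `f^∞`. -/
theorem exists_sub_mem_span (a : MonoidAlgebra K (borel cs)) :
    ∃ b : MonoidAlgebra K (borel cs), (∀ f, ¬ IsIdempotentElem f → b.coeff f = 0) ∧
      b - a ∈ Submodule.span K (Set.range (stableDiff cs K)) := by
  classical
  induction a using MonoidAlgebra.induction_on with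
  | of f =>
    refine ⟨MonoidAlgebra.of K (borel cs) (stablePow cs f), fun g hg => ?_, ?_⟩
    · have h1 : stablePow cs f ≠ g := fun h' => hg (h' ▸ isIdempotentElem_stablePow f)
      simp [MonoidAlgebra.of_apply, h1]
    · by_cases hf : IsIdempotentElem f
      · rw [stablePow_eq_self hf, sub_self]
        exact zero_mem _
      · exact Submodule.subset_span ⟨⟨f, hf⟩, rfl⟩
  | add a a' ha ha' =>
    obtain ⟨b, hb, h⟩ := ha
    obtain ⟨b', hb', h'⟩ := ha'
    refine ⟨b + b', fun f hf => by simp [hb f hf, hb' f hf], ?_⟩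
    rw [add_sub_add_comm]
    exact add_mem h h'
  | smul r a ha =>
    obtain ⟨b, hb, h⟩ := ha
    refine ⟨r • b, fun f hf => by rw [MonoidAlgebra.coeff_smul_apply, hb f hf, smul_zero], ?_⟩
    rw [← smul_sub]
    exact Submodule.smul_mem _ r h

theorem span_stableDiff : Submodule.span K (Set.range (stableDiff cs K)) =
    (Ring.jacobson (MonoidAlgebra K (borel cs))).restrictScalars K := by
  ext a
  rw [Submodule.restrictScalars_mem, mem_jacobson_iff_weightHom]
  refine ⟨weightHom_eq_zero_of_mem_span, fun ha => ?_⟩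
  obtain ⟨b, hb, h⟩ := exists_sub_mem_span a
  have hb0 : b = 0 := eq_zero_of_weightHom_eq_zero hb fun x => by
    have := weightHom_eq_zero_of_mem_span h x
    rwa [map_sub, ha, sub_zero] at this
  rw [hb0, zero_sub] at h
  exact neg_mem_iff.1 h

theorem quotient_jacobson_mul_comm (a b : MonoidAlgebra K (borel cs) ⧸
    Ring.jacobson (MonoidAlgebra K (borel cs))) : a * b = b * a := by
  obtain ⟨a, rfl⟩ := Ideal.Quotient.mk_surjective a
  obtain ⟨b, rfl⟩ := Ideal.Quotient.mk_surjective b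
  -- Characters with values in a field kill commutators.
  rw [← map_mul, ← map_mul, Ideal.Quotient.mk_eq_mk_iff_sub_mem, mem_jacobson_iff_weightHom]
  intro x
  rw [map_sub, map_mul, map_mul, mul_comm, sub_self]

/-! ### Simple modules -/

instance isSimpleModule_simpleMod (x : W) :
    IsSimpleModule (MonoidAlgebra K (borel cs))ᵐᵒᵖ (SimpleMod cs K x) := by
  rw [isSimpleModule_iff_toSpanSingleton_surjective]
  refine ⟨inferInstanceAs (Nontrivial K), fun c hc d => ?_⟩
  let c' : K := c
  let d' : K := d
  refine ⟨MulOpposite.op (algebraMap K _ (d' * c'⁻¹)), ?_⟩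
  rw [LinearMap.toSpanSingleton_apply, smul_simpleMod, MulOpposite.unop_op, AlgHom.commutes]
  change d' * c'⁻¹ * c' = d'
  rw [mul_assoc, inv_mul_cancel₀ hc, mul_one]

/-- Comparing the action of `f` on `ε_x` and on its nonzero image shows that `f` fixes `x` exactly
when it fixes `y`. -/
theorem eq_of_linearEquiv_simpleMod {x y : W} (e : SimpleMod cs K x
    ≃ₗ[(MonoidAlgebra K (borel cs))ᵐᵒᵖ] SimpleMod cs K y) : x = y := by
  classical
  have hne : e (epsilon cs K x) ≠ 0 := by
    rw [e.map_ne_zero_iff]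
    exact one_ne_zero (α := K)
  refine eq_of_act_eq_iff (cs := cs) fun f => ?_
  have h := e.map_smul (MulOpposite.op (MonoidAlgebra.of K (borel cs) f)) (epsilon cs K x)
  rw [epsilon_smul, smul_simpleMod, MulOpposite.unop_op, weightHom_of] at h
  by_cases h1 : act cs x f = x <;> by_cases h2 : act cs y f = y
  · simp [h1, h2]
  · rw [if_pos h1, if_neg h2, zero_smul] at h
    exact absurd h hne
  · rw [if_neg h1, if_pos h2, map_zero, one_smul] at h
    exact absurd h.symm hne
  · simp [h1, h2]

section Classification

variable {V : Type*} [AddCommGroup V] [Module (MonoidAlgebra K (borel cs))ᵐᵒᵖ V]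

theorem op_smul_eq_zero_of_mem_lengthFiltration {v : V} {n : ℕ}
    (hv : ∀ h : borel cs, totalLength h < n →
      MulOpposite.op (MonoidAlgebra.of K (borel cs) h) • v = 0)
    {a : MonoidAlgebra K (borel cs)} (ha : a ∈ lengthFiltration cs K n) :
    MulOpposite.op a • v = 0 := by
  induction ha using Submodule.span_induction with
  | mem a ha =>
    obtain ⟨h, hh, rfl⟩ := ha
    exact hv h hh
  | zero => rw [MulOpposite.op_zero, zero_smul]
  | add a b _ _ ha hb => rw [MulOpposite.op_add, add_smul, ha, hb, add_zero]
  | smul r a _ ha =>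
    -- `V` has no `K`-structure here; the scalar acts through the algebra and, being central, can be
    -- made to act after `a`.
    rw [Algebra.smul_def, Algebra.commutes, MulOpposite.op_mul, mul_smul, ha, smul_zero]

/-- A nonzero right `K[M₁]`-module contains a common eigenvector, with eigenvalues given by one
of the characters. -/
theorem exists_eigenvector [Nontrivial V] : ∃ (x : W) (v : V), v ≠ 0 ∧
    ∀ a : MonoidAlgebra K (borel cs), MulOpposite.op a • v =
      MulOpposite.op (algebraMap K (MonoidAlgebra K (borel cs)) (weightHom cs K x a)) • v := by
  classical
  obtain ⟨v, hv⟩ := exists_ne (0 : V)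
  -- For `g` of minimal total length with `v.g ≠ 0`, the lower terms of `g * a` kill `v`, so `v.g`
  -- is the eigenvector; `g = 1` shows that such elements exist.
  have hex : ∃ n, ∃ g : borel cs, totalLength g = n ∧
      MulOpposite.op (MonoidAlgebra.of K (borel cs) g) • v ≠ 0 :=
    ⟨_, 1, rfl, by rwa [map_one, MulOpposite.op_one, one_smul]⟩
  obtain ⟨g, hg, hgv⟩ := Nat.find_spec hex
  refine ⟨act cs (longest cs) g, _, hgv, fun a => ?_⟩
  have hmin : ∀ h : borel cs, totalLength h < totalLength g →
      MulOpposite.op (MonoidAlgebra.of K (borel cs) h) • v = 0 := by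
    intro h hh
    by_contra hc
    rw [hg] at hh
    exact Nat.find_min hex hh ⟨h, rfl, hc⟩
  have h := op_smul_eq_zero_of_mem_lengthFiltration hmin (of_mul_sub_mem g a)
  rwa [Algebra.smul_def, Algebra.commutes, MulOpposite.op_sub, MulOpposite.op_mul,
    MulOpposite.op_mul, sub_smul, mul_smul, mul_smul, sub_eq_zero] at h

/-- The homomorphism from `S_x` given by an eigenvector. -/
noncomputable def simpleModHom (x : W) (v : V)
    (hv : ∀ a : MonoidAlgebra K (borel cs), MulOpposite.op a • v =
      MulOpposite.op (algebraMap K (MonoidAlgebra K (borel cs)) (weightHom cs K x a)) • v) :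
    SimpleMod cs K x →ₗ[(MonoidAlgebra K (borel cs))ᵐᵒᵖ] V where
  toFun := fun c : K => MulOpposite.op (algebraMap K (MonoidAlgebra K (borel cs)) c) • v
  map_add' :=
    have key (c d : K) : MulOpposite.op (algebraMap K (MonoidAlgebra K (borel cs)) (c + d)) • v =
        MulOpposite.op (algebraMap K (MonoidAlgebra K (borel cs)) c) • v +
          MulOpposite.op (algebraMap K (MonoidAlgebra K (borel cs)) d) • v := by
      rw [map_add, MulOpposite.op_add, add_smul]
    key
  map_smul' a :=
    have key (c : K) : MulOpposite.op (algebraMap K (MonoidAlgebra K (borel cs))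
        (weightHom cs K x a.unop * c)) • v =
          a • MulOpposite.op (algebraMap K (MonoidAlgebra K (borel cs)) c) • v := by
      obtain ⟨a, rfl⟩ := MulOpposite.op_surjective a
      rw [← mul_smul, ← MulOpposite.op_mul, hv (_ * a), map_mul (weightHom cs K x),
        AlgHom.commutes, mul_comm]
      rfl
    key

theorem exists_linearEquiv_simpleMod
    [IsSimpleModule (MonoidAlgebra K (borel cs))ᵐᵒᵖ V] :
    ∃ x : W, Nonempty (V ≃ₗ[(MonoidAlgebra K (borel cs))ᵐᵒᵖ] SimpleMod cs K x) := by
  have := IsSimpleModule.nontrivial (MonoidAlgebra K (borel cs))ᵐᵒᵖ V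
  obtain ⟨x, v, hv0, hv⟩ := exists_eigenvector (K := K) (cs := cs) (V := V)
  have hne : simpleModHom x v hv ≠ 0 := by
    intro h
    have h1 := LinearMap.congr_fun h (epsilon cs K x)
    change MulOpposite.op (algebraMap K (MonoidAlgebra K (borel cs)) 1) • v = 0 at h1
    rw [map_one, MulOpposite.op_one, one_smul] at h1
    exact hv0 h1
  exact ⟨x, ⟨(LinearEquiv.ofBijective _ (LinearMap.bijective_of_ne_zero hne)).symm⟩⟩

theorem finrank_eq_one_of_isSimpleModule [Module K V]
    [IsScalarTower K (MonoidAlgebra K (borel cs))ᵐᵒᵖ V]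
    [IsSimpleModule (MonoidAlgebra K (borel cs))ᵐᵒᵖ V] : Module.finrank K V = 1 := by
  obtain ⟨x, ⟨e⟩⟩ := exists_linearEquiv_simpleMod (K := K) (cs := cs) (V := V)
  rw [(e.restrictScalars K).finrank_eq]
  exact Module.finrank_self K

end Classification

end Algebra

end BiHecke

theorem mainTheorem10 {B : Type*} {W : Type*} [Group W] [Finite W]
    {M : CoxeterMatrix B} (cs : CoxeterSystem M W) (K : Type*) [Field K] :
    -- the family of all `f^∞ - f`, for `f ∈ M₁` not idempotent, is a basis of the radical
    (LinearIndependent K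
        (fun f : {f : BiHecke.borel cs // ¬ IsIdempotentElem f} =>
          MonoidAlgebra.of K (BiHecke.borel cs) (BiHecke.stablePow cs f.1) -
            MonoidAlgebra.of K (BiHecke.borel cs) f.1) ∧
      Submodule.span K
        (Set.range (fun f : {f : BiHecke.borel cs // ¬ IsIdempotentElem f} =>
          MonoidAlgebra.of K (BiHecke.borel cs) (BiHecke.stablePow cs f.1) -
            MonoidAlgebra.of K (BiHecke.borel cs) f.1)) =
        (Ring.jacobson (MonoidAlgebra K (BiHecke.borel cs))).restrictScalars K) ∧
    -- the quotient by the radical is commutative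
    (∀ a b : MonoidAlgebra K (BiHecke.borel cs) ⧸
        Ring.jacobson (MonoidAlgebra K (BiHecke.borel cs)), a * b = b * a) ∧
    -- every simple right module is one-dimensional
    (∀ (V : Type*) [AddCommGroup V] [Module K V]
        [Module (MonoidAlgebra K (BiHecke.borel cs))ᵐᵒᵖ V]
        [IsScalarTower K (MonoidAlgebra K (BiHecke.borel cs))ᵐᵒᵖ V]
        [IsSimpleModule (MonoidAlgebra K (BiHecke.borel cs))ᵐᵒᵖ V],
        Module.finrank K V = 1) ∧
    -- the `S_w` are simple, pairwise non-isomorphic, and exhaust the simple right modules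
    (∀ w : W, IsSimpleModule (MonoidAlgebra K (BiHecke.borel cs))ᵐᵒᵖ
        (BiHecke.SimpleMod cs K w)) ∧
    (∀ w w' : W, Nonempty (BiHecke.SimpleMod cs K w
        ≃ₗ[(MonoidAlgebra K (BiHecke.borel cs))ᵐᵒᵖ] BiHecke.SimpleMod cs K w') → w = w') ∧
    (∀ (V : Type*) [AddCommGroup V] [Module (MonoidAlgebra K (BiHecke.borel cs))ᵐᵒᵖ V]
        [IsSimpleModule (MonoidAlgebra K (BiHecke.borel cs))ᵐᵒᵖ V],
        ∃ w : W, Nonempty (V ≃ₗ[(MonoidAlgebra K (BiHecke.borel cs))ᵐᵒᵖ]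
          BiHecke.SimpleMod cs K w)) := by
  exact ⟨⟨BiHecke.linearIndependent_stableDiff, BiHecke.span_stableDiff⟩,
    BiHecke.quotient_jacobson_mul_comm, fun V => BiHecke.finrank_eq_one_of_isSimpleModule (cs := cs),
    fun w => inferInstance, fun _ _ ⟨e⟩ => BiHecke.eq_of_linearEquiv_simpleMod e,
    fun V => BiHecke.exists_linearEquiv_simpleMod⟩
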